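/- Consider register machines (addition machines) whose registers hold arbitrary integers and whose instructions, each costing one step, are: assign to a register the sum or difference of two registers, the sum or difference (in either order) of a register and an integer constant, or an integer constant; read the next input number into a register; write a register; jump to a fixed line depending on a comparison ($<,=,>,\neq,\le,\ge$) of two registers or of a register with a constant; jump unconditionally. In the Floyd–Knuth model the operations and comparisons with constants are not available. For integers $x,y$ let $$F(x,y)=\begin{cases}0 & \text{if } y\le 0 \text{ or } x\le y,\\ 2^k\cdot x \text{ with } k\ge 1 \text{ least such that } 2^k\cdot y\ge x & \text{otherwise.}\end{cases}$$ (1) $F$ is computed in linear time by a program with two registers which uses no constants, so that the program is a program of the Floyd–Knuth model as well: there are such a program and a constant $K$ such that for all integers $x,y$, given the input sequence $y,x$ and arbitrary initial register contents, the program halts after at most $K\cdot n$ steps having written exactly the number $F(x,y)$. Here $n$ is the number of inputs (two) plus the sum of the numbers of binary digits of $x$ and $y$, where the number of binary digits of an integer $u$ is the least $m\ge 1$ with $-2^m<u<2^m$. (2) $F$ is not automatic for any choice of bases, even when restricted to natural numbers: for all integers $a,b,c\ge 2$ there is no deterministic finite automaton which, for all $x,y,z\in\mathbb N$, when reading synchronously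 the base-$a$ digits of $x$, the base-$b$ digits of $y$ and the base-$c$ digits of $z$ (most significant digit first, padded with leading zeros to the length of the longest of the three digit sequences), accepts if and only if $z=F(x,y)$. -/

import Mathlib

namespace AdditionMachine

/-- The comparison operators which may be used in tests. -/
inductive Cmp
  | lt | eq | gt | ne | le | ge

/-- The meaning of a comparison operator on the integers. -/
def Cmp.eval : Cmp → ℤ → ℤ → Bool
  | .lt, u, v => decide (u < v)
  | .eq, u, v => decide (u = v)
  | .gt, u, v => decide (v < u)
  | .ne, u, v => decide (u ≠ v)
  | .le, u, v => decide (u ≤ v)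
  | .ge, u, v => decide (v ≤ u)

/-- Instructions of a register machine (addition machine) with `r` integer registers.
Lines of a program are numbered from `0`; `if … then begin … end else begin … end` is expressed by
the conditional jumps. Every instruction counts as one step. -/
inductive Instr (r : ℕ)
  /-- let `x = y + z` -/
  | add (x y z : Fin r)
  /-- let `x = y - z` -/
  | sub (x y z : Fin r)
  /-- let `x = y + k` -/
  | addConst (x y : Fin r) (k : ℤ)
  /-- let `x = y - k` -/
  | subConst (x y : Fin r) (k : ℤ)
  /-- let `x = k - y` -/
  | constSub (x : Fin r) (k : ℤ) (y : Fin r)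
  /-- let `x = k` -/
  | setConst (x : Fin r) (k : ℤ)
  /-- read the next input number into `x` -/
  | read (x : Fin r)
  /-- append the content of `x` to the output -/
  | write (x : Fin r)
  /-- if `x R y` then goto line `l` (otherwise go on with the next line) -/
  | jumpIf (R : Cmp) (x y : Fin r) (l : ℕ)
  /-- if `x R k` then goto line `l` (otherwise go on with the next line) -/
  | jumpIfConst (R : Cmp) (x : Fin r) (k : ℤ) (l : ℕ)
  /-- goto line `l` -/
  | goto (l : ℕ)

/-- The instructions of the Floyd–Knuth model, which has no operations with constants and no
comparisons with constants. -/
def Instr.ConstantFree {r : ℕ} : Instr r → Prop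
  | .add _ _ _ | .sub _ _ _ | .read _ | .write _ | .jumpIf _ _ _ _ | .goto _ => True
  | .addConst _ _ _ | .subConst _ _ _ | .constSub _ _ _ | .setConst _ _
  | .jumpIfConst _ _ _ _ => False

/-- A program with `r` registers is a finite list of lines. -/
abbrev Program (r : ℕ) := List (Instr r)

/-- A program of the Floyd–Knuth model. -/
def Program.ConstantFree {r : ℕ} (P : Program r) : Prop := ∀ i ∈ P, i.ConstantFree

/-- A configuration: the current line, the register contents, the input numbers not yet read (in
the order in which they will be read), and the numbers written so far. -/
structure Config (r : ℕ) where
  line : ℕ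
  reg : Fin r → ℤ
  input : List ℤ
  output : List ℤ

/-- Go on with the next line, with `v` assigned to the register `x`. -/
def Config.assign {r : ℕ} (C : Config r) (x : Fin r) (v : ℤ) : Config r :=
  { C with line := C.line + 1, reg := Function.update C.reg x v }

/-- Go to line `l` if `t` holds, and go on with the next line otherwise. -/
def Config.branch {r : ℕ} (C : Config r) (t : Bool) (l : ℕ) : Config r :=
  { C with line := if t then l else C.line + 1 }

/-- The effect of executing one instruction; a `read` with no input left is blocked (`none`). -/
def Instr.exec {r : ℕ} (C : Config r) : Instr r → Option (Config r)
  | .add x y z => some (C.assign x (C.reg y + C.reg z))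
  | .sub x y z => some (C.assign x (C.reg y - C.reg z))
  | .addConst x y k => some (C.assign x (C.reg y + k))
  | .subConst x y k => some (C.assign x (C.reg y - k))
  | .constSub x k y => some (C.assign x (k - C.reg y))
  | .setConst x k => some (C.assign x k)
  | .read x =>
      match C.input with
      | [] => none
      | v :: rest => some { C.assign x v with input := rest }
  | .write x => some { C with line := C.line + 1, output := C.output ++ [C.reg x] }
  | .jumpIf R x y l => some (C.branch (R.eval (C.reg x) (C.reg y)) l)
  | .jumpIfConst R x k l => some (C.branch (R.eval (C.reg x) k) l)
  | .goto l => some { C with line := l }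

/-- One step of a program. -/
def Program.step {r : ℕ} (P : Program r) (C : Config r) : Option (Config r) :=
  P[C.line]?.bind (Instr.exec C)

/-- The configuration reached after exactly `t` steps, if there is one. -/
def Program.run {r : ℕ} (P : Program r) : ℕ → Config r → Option (Config r)
  | 0, C => some C
  | t + 1, C => (P.step C).bind (Program.run P t)

/-- A program ends when control has left its list of lines. -/
def Program.Halted {r : ℕ} (P : Program r) (C : Config r) : Prop := P.length ≤ C.line

/-- On the input sequence `inp`, whatever the registers contain at the start, the program halts
after at most `T` steps, having written the number `v` and nothing else. -/
def Program.OutputsWithin {r : ℕ} (P : Program r) (inp : List ℤ) (v : ℤ) (T : ℕ) : Prop :=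
  ∀ ρ : Fin r → ℤ, ∃ t ≤ T, ∃ C : Config r,
    P.run t { line := 0, reg := ρ, input := inp, output := [] } = some C ∧
      P.Halted C ∧ C.output = [v]

/-- The number of binary digits of an integer: the least `n ≥ 1` with `-2 ^ n < x < 2 ^ n`. -/
noncomputable def bitLength (x : ℤ) : ℕ := sInf {n : ℕ | 1 ≤ n ∧ -2 ^ n < x ∧ x < 2 ^ n}

/-- The size of an input sequence: the sum of the numbers of digits plus the number of inputs. -/
noncomputable def inputSize (inp : List ℤ) : ℕ := (inp.map bitLength).sum + inp.length

/-- The digit of `x` in base `b` at the position of `b ^ p`. -/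
def digit (b : ℕ) (hb : 2 ≤ b) (x p : ℕ) : Fin b :=
  ⟨x / b ^ p % b, Nat.mod_lt _ (by omega)⟩

/-- The convolution of the base-`a` digits of `x`, the base-`b` digits of `y` and the base-`c`
digits of `z`, most significant digits first: the three digit sequences are aligned at the back and
padded with leading zeros to the length of the longest one. -/
def convolution {a b c : ℕ} (ha : 2 ≤ a) (hb : 2 ≤ b) (hc : 2 ≤ c) (x y z : ℕ) :
    List (Fin a × Fin b × Fin c) :=
  let m := max (a.digits x).length (max (b.digits y).length (c.digits z).length)
  ((List.range m).map fun p => (digit a ha x p, digit b hb y p, digit c hc z p)).reverse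

/-- `F`, restricted to the natural numbers, is automatic when its first input, its second input and
its output are written in the bases `a`, `b` and `c`: some deterministic finite automaton, reading
the three digit sequences symbol by symbol at the same speed, recognises whether the third number
is the value of `F` at the first two. -/
def IsAutomatic {a b c : ℕ} (ha : 2 ≤ a) (hb : 2 ≤ b) (hc : 2 ≤ c) (F : ℤ → ℤ → ℤ) : Prop :=
  ∃ (σ : Type) (_ : Fintype σ) (M : DFA (Fin a × Fin b × Fin c) σ),
    ∀ x y z : ℕ, convolution ha hb hc x y z ∈ M.accepts ↔ (z : ℤ) = F x y

/-- The function mapping `(x, y)` to `2 ^ k * x` for the least `k ≥ 1` with `2 ^ k * y ≥ x`, and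
to `0` in the degenerate cases `y ≤ 0` and `x ≤ y`. -/
noncomputable def scaledInput (x y : ℤ) : ℤ :=
  if y ≤ 0 ∨ x ≤ y then 0 else 2 ^ sInf {k : ℕ | 1 ≤ k ∧ x ≤ 2 ^ k * y} * x

end AdditionMachine

/-! Part (1): each pass of the loop doubles the register holding `x` and quadruples the one holding
`y`. After `k` passes they hold `2 ^ k * x` and `4 ^ k * y`, and `4 ^ k * y < 2 ^ k * x` iff `2 ^ k
* y < x`. So comparing the two registers finds the least `k` without a third register, and the
output is already in place. The number of passes is at most the bit length of `x`.

Part (2): fix `y = 1`. Between consecutive powers of 2 the function is multiplication by a fixed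
power of 2, which can be made as large as desired. On a block of `a ^ p` numbers sharing all but
their last `p` base-`a` digits, the values then have pairwise different parts above the last `p`
base-`c` digits. An automaton must remember which of these parts it has read, which for large `p`
exceeds its number of states (`not_isAutomatic_of_gaps`). -/

namespace AdditionMachine

/-! ### The program and its running time -/

/-- Reads `y` and `x`, then doubles `x` and quadruples `y` until the second is at least the
first. -/
def scaleProgram : Program 2 :=
  [.read 0, .sub 1 0 0, .jumpIf .le 0 1 10, .read 1, .jumpIf .le 1 0 10,
    .add 1 1 1, .add 0 0 0, .add 0 0 0, .jumpIf .lt 0 1 5, .goto 11,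
    .sub 1 1 1, .write 1]

theorem scaleProgram_constantFree : scaleProgram.ConstantFree := by
  simp [Program.ConstantFree, scaleProgram, Instr.ConstantFree]

theorem Program.run_add {r : ℕ} (P : Program r) {s t : ℕ} {C D : Config r}
    (h : P.run s C = some D) : P.run (s + t) C = P.run t D := by
  induction s generalizing C with
  | zero =>
    simp only [Program.run, Option.some.injEq] at h
    simp [h]
  | succ s ih =>
    rw [Nat.add_right_comm]
    simp only [Program.run] at h ⊢
    cases hC : P.step C with
    | none => simp [hC] at h
    | some C' =>
      rw [hC] at h
      simpa using ih h

/-- One pass through the loop. -/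
theorem scaleProgram_run_pass (ρ : Fin 2 → ℤ) (inp out : List ℤ) :
    ∃ ρ' : Fin 2 → ℤ, ρ' 0 = 4 * ρ 0 ∧ ρ' 1 = 2 * ρ 1 ∧
      scaleProgram.run 4 ⟨5, ρ, inp, out⟩ =
        some ⟨if 4 * ρ 0 < 2 * ρ 1 then 5 else 9, ρ', inp, out⟩ := by
  have h4 : ρ 0 + ρ 0 + (ρ 0 + ρ 0) = 4 * ρ 0 := by ring
  have h2 : ρ 1 + ρ 1 = 2 * ρ 1 := by ring
  refine ⟨![4 * ρ 0, 2 * ρ 1], rfl, rfl, ?_⟩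
  simp only [Program.run, Program.step, scaleProgram, Instr.exec, Config.assign, Config.branch,
    Cmp.eval, Option.bind_some, List.getElem?_cons_succ, List.getElem?_cons_zero]
  simp only [Function.update_self, ne_eq, zero_ne_one, one_ne_zero, not_false_eq_true,
    Function.update_of_ne, h4, h2, decide_eq_true_eq, Option.some.injEq, Config.mk.injEq,
    and_true, true_and]
  funext i
  fin_cases i <;> simp

/-- Induction on the number `n + 1` of passes left: a pass replaces `(y, x)` by `(4 * y, 2 * x)`, so
the condition at `i` for the new registers is the one at `i + 1` for the old. A pass takes four
steps; the final jump and the write take two more. -/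
theorem scaleProgram_run_loop (n : ℕ) (ρ : Fin 2 → ℤ) (inp out : List ℤ)
    (hlt : ∀ i, 1 ≤ i → i ≤ n → 2 ^ i * ρ 0 < ρ 1) (hle : ρ 1 ≤ 2 ^ (n + 1) * ρ 0) :
    ∃ C, scaleProgram.run (4 * (n + 1) + 2) ⟨5, ρ, inp, out⟩ = some C ∧
      scaleProgram.Halted C ∧ C.output = out ++ [2 ^ (n + 1) * ρ 1] := by
  induction n generalizing ρ with
  | zero =>
    obtain ⟨ρ', h0, h1, hrun⟩ := scaleProgram_run_pass ρ inp out
    rw [if_neg (by simp at hle; linarith)] at hrun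
    refine ⟨⟨12, ρ', inp, out ++ [ρ' 1]⟩, ?_, ?_, ?_⟩
    · rw [Program.run_add _ hrun]
      rfl
    · simp [Program.Halted, scaleProgram]
    · simp [h1]
  | succ n ih =>
    obtain ⟨ρ', h0, h1, hrun⟩ := scaleProgram_run_pass ρ inp out
    rw [if_pos (by have := hlt 1 le_rfl (by omega); linarith)] at hrun
    obtain ⟨C, hC, hH, hout⟩ := ih ρ'
      (fun i hi hin => by
        have := hlt (i + 1) (by omega) (by omega)
        rw [pow_succ] at this
        rw [h0, h1]
        linarith)
      (by
        rw [pow_succ] at hle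
        rw [h0, h1]
        linarith)
    refine ⟨C, ?_, hH, ?_⟩
    · rw [show 4 * (n + 1 + 1) + 2 = 4 + (4 * (n + 1) + 2) by ring, Program.run_add _ hrun, hC]
    · rw [hout, h1, pow_succ _ (n + 1), mul_assoc]

theorem bitLength_spec (x : ℤ) : 1 ≤ bitLength x ∧ -2 ^ bitLength x < x ∧ x < 2 ^ bitLength x := by
  refine Nat.sInf_mem (s := {n : ℕ | 1 ≤ n ∧ -2 ^ n < x ∧ x < 2 ^ n}) ⟨x.natAbs + 1, ?_⟩
  have h : ((x.natAbs + 1 : ℕ) : ℤ) < 2 ^ (x.natAbs + 1) := by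
    exact_mod_cast Nat.lt_two_pow_self
  push_cast at h
  refine ⟨by omega, ?_, ?_⟩
  · have := neg_abs_le x; linarith
  · have := le_abs_self x; linarith

theorem scaledInput_of_least {x y : ℤ} {n : ℕ} (hy : 0 < y) (hxy : y < x)
    (hlt : ∀ i, 1 ≤ i → i ≤ n → 2 ^ i * y < x) (hle : x ≤ 2 ^ (n + 1) * y) :
    scaledInput x y = 2 ^ (n + 1) * x := by
  have hk : sInf {k : ℕ | 1 ≤ k ∧ x ≤ 2 ^ k * y} = n + 1 := by
    refine IsLeast.csInf_eq ⟨⟨by omega, hle⟩, fun k hk => ?_⟩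
    by_contra hkn
    exact absurd hk.2 (not_le.mpr (hlt k hk.1 (by omega)))
  rw [scaledInput, if_neg (by omega), hk]

/-- Linear time comes from here: as `y ≥ 1`, the exponent `bitLength x` already suffices, so at most
that many passes occur. -/
theorem exists_least_scale {x y : ℤ} (hy : 0 < y) :
    ∃ n < bitLength x, (∀ i, 1 ≤ i → i ≤ n → 2 ^ i * y < x) ∧ x ≤ 2 ^ (n + 1) * y := by
  obtain ⟨hb, -, hx⟩ := bitLength_spec x
  have hmem : ∃ n : ℕ, x ≤ 2 ^ (n + 1) * y := by
    refine ⟨bitLength x - 1, ?_⟩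
    rw [Nat.sub_add_cancel hb]
    nlinarith [pow_pos (show (0 : ℤ) < 2 by norm_num) (bitLength x)]
  classical
  refine ⟨Nat.find hmem, ?_, fun i hi hin => ?_, Nat.find_spec hmem⟩
  · refine lt_of_le_of_lt (Nat.find_min' hmem (m := bitLength x - 1) ?_) (by omega)
    rw [Nat.sub_add_cancel hb]
    nlinarith [pow_pos (show (0 : ℤ) < 2 by norm_num) (bitLength x)]
  · have := Nat.find_min hmem (m := i - 1) (by omega)
    rwa [Nat.sub_add_cancel hi, not_le] at this

theorem scaleProgram_outputsWithin (x y : ℤ) :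
    scaleProgram.OutputsWithin [y, x] (scaledInput x y) (4 * inputSize [y, x]) := by
  intro ρ
  have hsize : inputSize [y, x] = bitLength y + bitLength x + 2 := by
    simp [inputSize]
  have hbx := (bitLength_spec x).1
  have hby := (bitLength_spec y).1
  rcases le_or_gt y 0 with hy | hy
  -- The program stops here without reading `x`, which stays in the input.
  · refine ⟨5, by omega, ⟨12, ![y, 0], [x], [0]⟩, ?_, by simp [Program.Halted, scaleProgram], ?_⟩
    · simp [Program.run, Program.step, scaleProgram, Instr.exec, Config.assign, Config.branch,
        Cmp.eval, hy]
      funext i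
      fin_cases i <;> simp
    · simp [scaledInput, hy]
  rcases le_or_gt x y with hxy | hxy
  · refine ⟨7, by omega, ⟨12, ![y, 0], [], [0]⟩, ?_, by simp [Program.Halted, scaleProgram], ?_⟩
    · simp [Program.run, Program.step, scaleProgram, Instr.exec, Config.assign, Config.branch,
        Cmp.eval, hy.not_ge, hxy]
      funext i
      fin_cases i <;> simp
    · simp [scaledInput, hxy]
  obtain ⟨n, hn, hlt, hle⟩ := exists_least_scale (x := x) hy
  have hstart : scaleProgram.run 5 ⟨0, ρ, [y, x], []⟩ = some ⟨5, ![y, x], [], []⟩ := by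
    simp [Program.run, Program.step, scaleProgram, Instr.exec, Config.assign, Config.branch,
      Cmp.eval, hy.not_ge, hxy.not_ge]
    funext i
    fin_cases i <;> simp
  obtain ⟨C, hC, hH, hout⟩ := scaleProgram_run_loop n ![y, x] [] [] hlt hle
  refine ⟨5 + (4 * (n + 1) + 2), by omega, C, ?_, hH, ?_⟩
  · rw [Program.run_add _ hstart, hC]
  · rw [hout, scaledInput_of_least hy hxy hlt hle]
    rfl

/-! ### Splitting a convolution into high and low digits -/

theorem length_digits_eq_add {b : ℕ} (hb : 2 ≤ b) (p x : ℕ) (hx : 0 < x / b ^ p) :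
    (b.digits x).length = (b.digits (x / b ^ p)).length + p := by
  induction p generalizing x with
  | zero => simp
  | succ p ih =>
    have hdiv : x / b ^ (p + 1) = x / b / b ^ p := by
      rw [Nat.div_div_eq_div_mul, pow_succ']
    have hpos : 0 < x := Nat.pos_of_ne_zero fun h => by simp [h] at hx
    rw [hdiv] at hx ⊢
    rw [Nat.digits_def' (by omega) hpos, List.length_cons, ih _ hx]
    rfl

/-- The symbols of the convolution which stand for the `n` positions from position `p` on. -/
def digitBlock {a b c : ℕ} (ha : 2 ≤ a) (hb : 2 ≤ b) (hc : 2 ≤ c) (x y z p n : ℕ) :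
    List (Fin a × Fin b × Fin c) :=
  ((List.range n).map fun i =>
    (digit a ha x (p + i), digit b hb y (p + i), digit c hc z (p + i))).reverse

theorem digit_add (b : ℕ) (hb : 2 ≤ b) (x p i : ℕ) :
    digit b hb x (p + i) = digit b hb (x / b ^ p) i := by
  simp [digit, Nat.div_div_eq_div_mul, pow_add]

theorem digit_eq_of_mod_eq {b : ℕ} (hb : 2 ≤ b) {x x' p i : ℕ} (hi : i < p)
    (h : x % b ^ p = x' % b ^ p) : digit b hb x i = digit b hb x' i := by
  have key : ∀ u : ℕ, u / b ^ i % b = u % b ^ p / b ^ i % b := fun u => by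
    obtain ⟨d, rfl⟩ := Nat.exists_eq_add_of_lt hi
    rw [show i + d + 1 = i + (d + 1) by ring, pow_add, Nat.mod_mul_right_div_self, pow_succ',
      Nat.mod_mul_right_mod]
  simp only [digit, Fin.mk.injEq]
  rw [key x, key x', h]

theorem digitBlock_congr_high {a b c : ℕ} (ha : 2 ≤ a) (hb : 2 ≤ b) (hc : 2 ≤ c)
    {x x' z z' p : ℕ} (y n : ℕ) (hx : x / a ^ p = x' / a ^ p) (hz : z / c ^ p = z' / c ^ p) :
    digitBlock ha hb hc x y z p n = digitBlock ha hb hc x' y z' p n := by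
  simp only [digitBlock, digit_add, hx, hz]

theorem digitBlock_congr_low {a b c : ℕ} (ha : 2 ≤ a) (hb : 2 ≤ b) (hc : 2 ≤ c)
    {z z' p : ℕ} (x y : ℕ) (hz : z % c ^ p = z' % c ^ p) :
    digitBlock ha hb hc x y z 0 p = digitBlock ha hb hc x y z' 0 p := by
  simp only [digitBlock, zero_add]
  congr 1
  refine List.map_congr_left fun i hi => ?_
  rw [digit_eq_of_mod_eq hc (List.mem_range.mp hi) hz]

/-- The number of symbols of the convolution above position `p`, in terms of the high parts. -/
def highLength (a b c y h g p : ℕ) : ℕ :=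
  max ((a.digits h).length + p) (max (b.digits y).length ((c.digits g).length + p)) - p

/-- Nonzero high parts make the digit counts of `x` and `z` equal to `p` plus those of the high
parts. Hence, for fixed `y`, the padding of the upper block does not depend on the low digits of `x`
and `z`, and upper blocks can be exchanged. -/
theorem convolution_eq_append {a b c : ℕ} (ha : 2 ≤ a) (hb : 2 ≤ b) (hc : 2 ≤ c) (x y z p : ℕ)
    (hx : 0 < x / a ^ p) (hz : 0 < z / c ^ p) :
    convolution ha hb hc x y z =
      digitBlock ha hb hc x y z p (highLength a b c y (x / a ^ p) (z / c ^ p) p) ++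
        digitBlock ha hb hc x y z 0 p := by
  have hm : max (a.digits x).length (max (b.digits y).length (c.digits z).length) =
      p + highLength a b c y (x / a ^ p) (z / c ^ p) p := by
    rw [length_digits_eq_add ha p x hx, length_digits_eq_add hc p z hz, highLength]
    omega
  simp only [convolution, digitBlock, hm, List.range_add, List.map_append, List.reverse_append,
    List.map_map, zero_add]
  rfl

/-! ### The pigeonhole argument -/

/-- A function with large gaps between its values on some block of `a ^ p` consecutive numbers
which differ in their last `p` digits only is not automatic. -/
theorem not_isAutomatic_of_gaps {a b c : ℕ} (ha : 2 ≤ a) (hb : 2 ≤ b) (hc : 2 ≤ c)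
    (F : ℤ → ℤ → ℤ) (y : ℕ)
    (hF : ∀ p : ℕ, ∃ h > 0, ∃ s ≥ c ^ p, ∀ r < a ^ p,
      F ((a ^ p * h + r : ℕ) : ℤ) y = ((s * (a ^ p * h + r) : ℕ) : ℤ)) :
    ¬ IsAutomatic ha hb hc F := by
  rintro ⟨σ, _, M, hM⟩
  obtain ⟨p, hp⟩ : ∃ p : ℕ, Fintype.card σ < a ^ p :=
    ⟨_, Nat.lt_pow_self (by omega)⟩
  obtain ⟨h, hpos, s, hs, hval⟩ := hF p
  have hap : 0 < a ^ p := by positivity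
  have hcp : 0 < c ^ p := by positivity
  let X : ℕ → ℕ := fun r => a ^ p * h + r
  let Z : ℕ → ℕ := fun r => s * X r
  have hX : ∀ r < a ^ p, X r / a ^ p = h := fun r hr => by
    rw [Nat.mul_add_div hap, Nat.div_eq_of_lt hr, add_zero]
  have hXpos : ∀ r, 0 < X r := fun r => by positivity
  have hZpos : ∀ r, 0 < Z r / c ^ p := fun r =>
    Nat.div_pos (hs.le.trans (Nat.le_mul_of_pos_right s (hXpos r))) hcp
  -- Values at consecutive arguments differ by `s ≥ c ^ p`, so dividing by `c ^ p` keeps them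
  -- distinct.
  have hZlt : ∀ r r', r < r' → Z r / c ^ p < Z r' / c ^ p := fun r r' hr => by
    have : Z r + c ^ p ≤ Z r' := calc
      Z r + c ^ p ≤ Z r + s := by omega
      _ = s * (X r + 1) := by simp only [Z]; ring
      _ ≤ Z r' := Nat.mul_le_mul_left s (by simp only [X]; omega)
    calc Z r / c ^ p < Z r / c ^ p + 1 := Nat.lt_succ_self _
      _ = (Z r + c ^ p) / c ^ p := (Nat.add_div_right _ hcp).symm
      _ ≤ _ := Nat.div_le_div_right this
  let n : ℕ → ℕ := fun r => highLength a b c y h (Z r / c ^ p) p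
  -- Two of the `a ^ p` upper blocks lead to the same state; their lengths may differ.
  obtain ⟨r, r', hne, heq⟩ := Fintype.exists_ne_map_eq_of_card_lt
    (fun r : Fin (a ^ p) => M.eval (digitBlock ha hb hc (X r) y (Z r) p (n r))) (by simpa using hp)
  -- The high digits of `Z r'` followed by the low digits of `Z r`: the automaton cannot tell this
  -- number from `Z r` as the value at `X r`.
  let z := c ^ p * (Z r' / c ^ p) + Z r % c ^ p
  have hmod : Z r % c ^ p < c ^ p := Nat.mod_lt _ hcp
  have hzdiv : z / c ^ p = Z r' / c ^ p := by
    rw [Nat.mul_add_div hcp, Nat.div_eq_of_lt hmod, add_zero]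
  have hzmod : z % c ^ p = Z r % c ^ p := by
    rw [Nat.mul_add_mod, Nat.mod_mod]
  have hconv : convolution ha hb hc (X r) y (Z r) =
      digitBlock ha hb hc (X r) y (Z r) p (n r) ++ digitBlock ha hb hc (X r) y (Z r) 0 p := by
    rw [convolution_eq_append ha hb hc _ _ _ p (by rwa [hX r r.2]) (hZpos r), hX r r.2]
  have hconv' : convolution ha hb hc (X r) y z =
      digitBlock ha hb hc (X r') y (Z r') p (n r') ++ digitBlock ha hb hc (X r) y (Z r) 0 p := by
    rw [convolution_eq_append ha hb hc _ _ _ p (by rwa [hX r r.2]) (hzdiv ▸ hZpos r'),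
      hX r r.2, hzdiv, digitBlock_congr_low ha hb hc _ _ hzmod,
      digitBlock_congr_high ha hb hc y _ ((hX r r.2).trans (hX r' r'.2).symm) hzdiv]
  have hacc : convolution ha hb hc (X r) y (Z r) ∈ M.accepts := (hM _ _ _).mpr (hval r r.2).symm
  have hacc' : convolution ha hb hc (X r) y z ∈ M.accepts := by
    rw [hconv, DFA.mem_accepts, DFA.eval, DFA.evalFrom_of_append] at hacc
    rw [hconv', DFA.mem_accepts, DFA.eval, DFA.evalFrom_of_append]
    have heq' : M.evalFrom M.start (digitBlock ha hb hc (X r) y (Z r) p (n r)) =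
      M.evalFrom M.start (digitBlock ha hb hc (X r') y (Z r') p (n r')) := heq
    rwa [← heq']
  have hz : z = Z r := by
    exact_mod_cast ((hM _ _ _).mp hacc').trans (hval r r.2)
  have hhigh : Z r / c ^ p = Z r' / c ^ p := by rw [← hz, hzdiv]
  rcases lt_or_gt_of_ne (fun h => hne (Fin.ext h)) with hlt | hlt
  · exact (hZlt _ _ hlt).ne hhigh
  · exact (hZlt _ _ hlt).ne' hhigh

/-! ### Blocks with large gaps for `scaledInput` -/

theorem scaledInput_one {x k : ℕ} (hlo : 2 ^ (k + 1) < x) (hhi : x ≤ 2 ^ (k + 2)) :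
    scaledInput x (1 : ℕ) = ((2 ^ (k + 2) * x : ℕ) : ℤ) := by
  have h1 : 1 < x := lt_of_le_of_lt Nat.one_le_two_pow hlo
  rw [scaledInput_of_least (n := k + 1) (by norm_num) (by exact_mod_cast h1)]
  · push_cast; rfl
  · intro i _ hi
    have : 2 ^ i < x := (Nat.pow_le_pow_right (by norm_num) hi).trans_lt hlo
    rw [Nat.cast_one, mul_one]
    exact_mod_cast this
  · rw [Nat.cast_one, mul_one]
    exact_mod_cast hhi

theorem not_isAutomatic_scaledInput {a b c : ℕ} (ha : 2 ≤ a) (hb : 2 ≤ b) (hc : 2 ≤ c) :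
    ¬ IsAutomatic ha hb hc scaledInput := by
  refine not_isAutomatic_of_gaps ha hb hc scaledInput 1 fun p => ?_
  set q := a ^ p with hq
  have hqpos : 0 < q := by positivity
  -- With this `k`, `2 ^ k` exceeds both `q` and `c ^ p`. The block starts at the first multiple of
  -- `q` above `2 ^ (k + 1)`, so it ends before `2 ^ (k + 1) + 2 * q < 2 ^ (k + 2)`, and the factor
  -- `2 ^ (k + 2)` is at least `c ^ p`.
  set k := q + c ^ p with hk
  have hkpow : k < 2 ^ k := Nat.lt_two_pow_self
  have h1 : 2 ^ (k + 1) = 2 * 2 ^ k := by ring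
  have h2 : 2 ^ (k + 2) = 4 * 2 ^ k := by ring
  have hdm := Nat.div_add_mod (2 ^ (k + 1)) q
  have hmod := Nat.mod_lt (2 ^ (k + 1)) hqpos
  refine ⟨2 ^ (k + 1) / q + 1, Nat.succ_pos _, 2 ^ (k + 2), by omega, fun r hr => ?_⟩
  rw [mul_add, mul_one]
  exact scaledInput_one (by omega) (by omega)

end AdditionMachine

theorem mainTheorem10 :
    (∃ P : AdditionMachine.Program 2, P.ConstantFree ∧
      ∃ K : ℕ, ∀ x y : ℤ,
        P.OutputsWithin [y, x] (AdditionMachine.scaledInput x y)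
          (K * AdditionMachine.inputSize [y, x])) ∧
    ∀ (a b c : ℕ) (ha : 2 ≤ a) (hb : 2 ≤ b) (hc : 2 ≤ c),
      ¬ AdditionMachine.IsAutomatic ha hb hc AdditionMachine.scaledInput :=
  ⟨⟨AdditionMachine.scaleProgram, AdditionMachine.scaleProgram_constantFree, 4,
    AdditionMachine.scaleProgram_outputsWithin⟩,
    fun _ _ _ ha hb hc => AdditionMachine.not_isAutomatic_scaledInput ha hb hc⟩
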